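/- Let $\mathcal X$ be a finite state space and, for each $x\in\mathcal X$, let $\mathcal J(x)$ be a finite non-empty set of actions. In a Markov decision process on these spaces, using action $a\in\mathcal J(x)$ in state $x$ produces a random pair (next state, one-step utility $u$) with joint law $\kappa(\cdot\mid x,a)$ on $\mathcal X\times\mathbb R$. Let $\gamma\in[0,1)$ be the discount factor. For a policy $\Phi$, that is, a choice of $\Phi(x)\in\mathcal J(x)$ for each $x$, let $Q^{\Phi}(x,a)=\sum_{t\ge 0}\gamma^{t}\,\mathbf E[u_t]$ be the expected discounted utility when the process starts in $x$ with action $a$ and follows $\Phi$ afterwards, and let $Q^{*}(x,a)=\max_{\Phi}Q^{\Phi}(x,a)$ be the optimal Q-function. An agent keeps a random table $Q_j(x,a)$, $j=0,1,2,\dots$, on a probability space with a filtration $(\mathcal F_j)$; $Q_0$ is $\mathcal F_0$-measurable. Its target table $\bar Q_j$ is a copy of the current table that is refreshed every $C\ge 1$ cycles, $\bar Q_j=Q_{C\lfloor j/C\rfloor}$ (for $C=1$, $\bar Q_j=Q_j$). In cycle $j$ every pair $(x,a)$ is updated by the double Q-learning rule $$Q_{j+1}(x,a)=Q_j(x,a)+\alpha_j(x,a)\Bigl(u_j+\gamma\,\bar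 Q_j\bigl(x',a^{\max}\bigr)-Q_j(x,a)\Bigr),\qquad a^{\max}\in\arg\max_{b\in\mathcal J(x')}Q_j(x',b),$$ where $\alpha_j(x,a)\in[0,1]$ is an $\mathcal F_j$-measurable learning rate, equal to $0$ if the pair is not updated in cycle $j$ (so the agent may follow a single trajectory and update only the visited pair, or it may update several or all pairs). The sample $(x',u_j)$, which may depend on $(x,a)$, is $\mathcal F_{j+1}$-measurable and, on the event $\alpha_j(x,a)\neq 0$, has conditional law $\kappa(\cdot\mid x,a)$ given $\mathcal F_j$. The choice among several maximizers $a^{\max}$ in each state is arbitrary but $\mathcal F_j$-measurable. Suppose that 1. the state and action spaces are finite, as above; 2. for every pair $(x,a)$, almost surely $\sum_{j}\alpha_j(x,a)=\infty$ and $\sum_{j}\alpha_j(x,a)^2<\infty$; 3. the variance of the one-step utility is bounded: there is $B<\infty$ such that, for every pair $(x,a)$, the utility $u$ under $\kappa(\cdot\mid x,a)$ has variance at most $B$. Then, with probability one, $Q_j(x,a)\to Q^{*}(x,a)$ as $j\to\infty$ for every $x\in\mathcal X$ and $a\in\mathcal J(x)$. -/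

import Mathlib

open MeasureTheory ProbabilityTheory Filter Topology
open scoped NNReal ENNReal

/-- A Markov decision process with state space `S` and action sets `A s`. Using action `a` in state
`s` produces a random pair (next state, one-step utility) with joint distribution `law s a`. -/
structure MDP (S : Type*) [MeasurableSpace S] (A : S → Type*) where
  law : ∀ s, A s → Measure (S × ℝ)
  isProbabilityMeasure_law : ∀ s a, IsProbabilityMeasure (law s a)

namespace MDP

variable {S : Type*} [MeasurableSpace S] {A : S → Type*}

/-- `M.expectedUtility Φ t s a` is the expected utility of step `t` when the process starts in
state `s` with action `a` and every later action is chosen by the policy `Φ`. -/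
noncomputable def expectedUtility (M : MDP S A) (Φ : ∀ s, A s) : ℕ → ∀ s, A s → ℝ
  | 0, s, a => ∫ x, x.2 ∂(M.law s a)
  | t + 1, s, a => ∫ x, expectedUtility M Φ t x.1 (Φ x.1) ∂(M.law s a)

/-- The Q-function of the policy `Φ`: the expected `γ`-discounted sum of the utilities obtained by
starting in `s` with action `a` and following `Φ` afterwards. -/
noncomputable def policyQ (M : MDP S A) (γ : ℝ) (Φ : ∀ s, A s) (s : S) (a : A s) : ℝ :=
  ∑' t : ℕ, γ ^ t * M.expectedUtility Φ t s a

/-- The optimal Q-function: the best discounted value over all policies. -/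
noncomputable def optimalQ (M : MDP S A) (γ : ℝ) (s : S) (a : A s) : ℝ :=
  ⨆ Φ : (∀ s, A s), M.policyQ γ Φ s a

/-- A run of tabular double Q-learning for the decision process `M`, with discount factor `γ`, on
the probability space `(Ω, P)` with history `ℱ`.

In cycle `j`, the entry of the state-action pair `(s, a)` is updated with learning rate `α j s a`
(the rate is `0` if the pair is not updated), using an observed next state `Y j s a` and utility
`U j s a`. An agent that follows a single trajectory has `α j s a = 0` unless `(s, a)` is the pair
visited in cycle `j`; updating all the pairs in each cycle is allowed as well.

`Q j` is the current table. The target table is a copy of the current table that is refreshed every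
`C` cycles, so that it is `Q (C * (j / C))` in cycle `j`; for `C = 1` the two tables agree.
`g j s` is the action which the current table rates best in state `s`. -/
structure IsDoubleQLearning {Ω : Type*} {mΩ : MeasurableSpace Ω} (M : MDP S A) (γ : ℝ) (C : ℕ)
    (P : Measure Ω) (ℱ : Filtration ℕ mΩ) (α : ℕ → ∀ s, A s → Ω → ℝ)
    (Y : ℕ → ∀ s, A s → Ω → S) (U : ℕ → ∀ s, A s → Ω → ℝ)
    (g : ℕ → ∀ s, Ω → A s) (Q : ℕ → ∀ s, A s → Ω → ℝ) : Prop where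
  measurable_init : ∀ s a, Measurable[ℱ 0] (Q 0 s a)
  measurable_rate : ∀ j s a, Measurable[ℱ j] (α j s a)
  rate_mem : ∀ j s a ω, α j s a ω ∈ Set.Icc (0 : ℝ) 1
  measurable_next : ∀ j s a, Measurable[ℱ (j + 1)] (Y j s a)
  measurable_utility : ∀ j s a, Measurable[ℱ (j + 1)] (U j s a)
  /-- If `(s, a)` is updated in cycle `j`, then the conditional distribution of the observed next
  state and utility, given the history up to then, is `M.law s a`. -/
  sample : ∀ j s a (D : Set Ω), MeasurableSet[ℱ j] D → D ⊆ {ω | α j s a ω ≠ 0} →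
    (P.restrict D).map (fun ω => (Y j s a ω, U j s a ω)) = P D • M.law s a
  measurable_greedy : ∀ j s b, MeasurableSet[ℱ j] {ω | g j s ω = b}
  greedy : ∀ j s b ω, Q j s b ω ≤ Q j s (g j s ω) ω
  update : ∀ j s a ω, Q (j + 1) s a ω = Q j s a ω + α j s a ω *
    (U j s a ω + γ * Q (C * (j / C)) (Y j s a ω) (g j (Y j s a ω) ω) ω - Q j s a ω)

end MDP

/-! By the Bellman equation (`MDP.optimalQ_eq`), Q* is the fixed point of a γ-contraction in the sup
norm. In each cycle every entry is averaged, with weight α, with a noisy value of this operator at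
the current table, up to the lag of the target table.

The noise is a martingale difference with square-summable weights, so its weighted series converges
almost surely (`exists_tendsto_sum_mul_sample`) and its averages vanish
(`tendsto_zero_of_averaging_noise`). Boundedness of the table comes first, because the noise from
the next state is scaled by table entries: the averages of |u| are bounded along almost every path,
and discounting turns this into a bound for the table (`exists_abs_le_of_discounted_averaging`).

On a bounded path the increments tend to 0, so a target less than C cycles old differs from the
current table by a vanishing error, which is added to the noise. Every eventual bound c on the
distance from Q* then improves to γc + ε, which forces convergence
(`tendsto_zero_of_contracting_averaging`). -/

/-! ### Deterministic averaging recursions. -/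

/-- A sequence that is moved towards values at most `c` by averaging steps whose weights have
infinite sum is eventually at most `c + ε`. -/
theorem eventually_le_add_of_averaging {a y : ℕ → ℝ} {c ε : ℝ}
    (ha : ∀ n, a n ∈ Set.Icc (0 : ℝ) 1)
    (hs : Tendsto (fun n => ∑ j ∈ Finset.range n, a j) atTop atTop) (N : ℕ)
    (h : ∀ n, N ≤ n → y (n + 1) ≤ (1 - a n) * y n + a n * c) (hε : 0 < ε) :
    ∀ᶠ n in atTop, y n ≤ c + ε := by
  set s : ℕ → ℝ := fun n => ∑ j ∈ Finset.range n, a j with hsdef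
  -- The excess over `c` shrinks by a factor 1 - a ≤ exp(-a) per step, and the exponents add up to a
  -- divergent sum.
  have key : ∀ n, N ≤ n → y n - c ≤ Real.exp (-(s n - s N)) * |y N - c| := by
    intro n hn
    induction n, hn using Nat.le_induction with
    | base => simpa using le_abs_self (y N - c)
    | succ n hn ih =>
      have h1 : y (n + 1) - c ≤ (1 - a n) * (y n - c) := by linarith [h n hn]
      have h2 : (1 - a n) * (y n - c) ≤ (1 - a n) * (Real.exp (-(s n - s N)) * |y N - c|) :=
        mul_le_mul_of_nonneg_left ih (by linarith [(ha n).2])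
      have h3 : (1 - a n) * (Real.exp (-(s n - s N)) * |y N - c|) ≤
          Real.exp (-a n) * (Real.exp (-(s n - s N)) * |y N - c|) :=
        mul_le_mul_of_nonneg_right (by linarith [Real.add_one_le_exp (-a n)]) (by positivity)
      have h4 : s (n + 1) = s n + a n := Finset.sum_range_succ _ _
      rw [h4, show -(s n + a n - s N) = -a n + -(s n - s N) by ring, Real.exp_add, mul_assoc]
      linarith
  have lim : Tendsto (fun n => Real.exp (-(s n - s N)) * |y N - c|) atTop (𝓝 0) := by
    have : Tendsto (fun n => s n - s N) atTop atTop :=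
      tendsto_atTop_add_const_right _ (-s N) hs
    simpa using (Real.tendsto_exp_neg_atTop_nhds_zero.comp this).mul_const |y N - c|
  filter_upwards [lim.eventually (gt_mem_nhds hε), eventually_ge_atTop N] with n h1 h2
  linarith [key n h2]

theorem tendsto_zero_of_averaging {a y e : ℕ → ℝ} (ha : ∀ n, a n ∈ Set.Icc (0 : ℝ) 1)
    (hs : Tendsto (fun n => ∑ j ∈ Finset.range n, a j) atTop atTop)
    (h : ∀ n, y (n + 1) = (1 - a n) * y n + a n * e n) (he : Tendsto e atTop (𝓝 0)) :
    Tendsto y atTop (𝓝 0) := by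
  rw [Metric.tendsto_atTop] at he
  rw [Metric.tendsto_nhds]
  intro ε hε
  obtain ⟨N, hN⟩ := he (ε / 3) (by positivity)
  have hN' : ∀ n, N ≤ n → |e n| < ε / 3 := fun n hn => by simpa using hN n hn
  have h1 := eventually_le_add_of_averaging (y := y) (c := ε / 3) ha hs N (fun n hn => by
    rw [h n]
    have := mul_le_mul_of_nonneg_left (abs_lt.1 (hN' n hn)).2.le (ha n).1
    linarith) (ε := ε / 3) (by positivity)
  have h2 := eventually_le_add_of_averaging (y := fun n => -y n) (c := ε / 3) ha hs N
    (fun n hn => by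
      simp only [h n]
      have := mul_le_mul_of_nonneg_left (abs_lt.1 (hN' n hn)).1.le (ha n).1
      linarith) (ε := ε / 3) (by positivity)
  filter_upwards [h1, h2] with n h1 h2
  rw [Real.dist_eq, sub_zero, abs_lt]
  constructor <;> linarith

/-- The averages of a noise sequence tend to zero if the series of the weighted noise converges. -/
theorem tendsto_zero_of_averaging_noise {a z w : ℕ → ℝ} {l : ℝ}
    (ha : ∀ n, a n ∈ Set.Icc (0 : ℝ) 1)
    (hs : Tendsto (fun n => ∑ j ∈ Finset.range n, a j) atTop atTop)
    (h : ∀ n, z (n + 1) = (1 - a n) * z n + a n * w n)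
    (hw : Tendsto (fun n => ∑ j ∈ Finset.range n, a j * w j) atTop (𝓝 l)) :
    Tendsto z atTop (𝓝 0) := by
  have he : Tendsto (fun n => l - ∑ j ∈ Finset.range n, a j * w j) atTop (𝓝 0) := by
    simpa using hw.const_sub l
  -- Adding the tail of the noise series to `z` cancels the noise: the sum averages the tails
  -- themselves, which tend to 0.
  have hy := tendsto_zero_of_averaging
    (y := fun n => z n + (l - ∑ j ∈ Finset.range n, a j * w j)) ha hs
    (fun n => by simp only [h n, Finset.sum_range_succ]; ring) he
  simpa using hy.sub he

/-- The sequence obtained by averaging the terms of `w` with weights `a`. -/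
noncomputable def averaging (a w : ℕ → ℝ) : ℕ → ℝ
  | 0 => 0
  | n + 1 => (1 - a n) * averaging a w n + a n * w n

/-- Averaging is linear in its inputs. Here `e` will be the error caused by the outdated target and
`w` the sampling noise. -/
theorem tendsto_averaging_add_noise {a e w : ℕ → ℝ} {l : ℝ}
    (ha : ∀ n, a n ∈ Set.Icc (0 : ℝ) 1)
    (hs : Tendsto (fun n => ∑ j ∈ Finset.range n, a j) atTop atTop)
    (he : Tendsto e atTop (𝓝 0))
    (hw : Tendsto (fun n => ∑ j ∈ Finset.range n, a j * w j) atTop (𝓝 l)) :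
    Tendsto (averaging a (fun n => e n + w n)) atTop (𝓝 0) := by
  have h1 := tendsto_zero_of_averaging (y := averaging a e) ha hs (fun n => rfl) he
  have h2 := tendsto_zero_of_averaging_noise (z := averaging a w) ha hs (fun n => rfl) hw
  have h3 : ∀ n, averaging a (fun n => e n + w n) n = averaging a e n + averaging a w n := by
    intro n
    induction n with
    | zero => simp [averaging]
    | succ n ih => simp only [averaging, ih]; ring
  simpa [funext h3] using h1.add h2

/-- A bounded asynchronous iteration of a contraction with vanishing averaged noise tends to the
fixed point; `d` is the distance from the fixed point. -/
theorem tendsto_zero_of_contracting_averaging {ι : Type*} [Finite ι] {γ K : ℝ} (hγ0 : 0 ≤ γ)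
    (hγ1 : γ < 1) {a d G w : ι → ℕ → ℝ} (ha : ∀ i n, a i n ∈ Set.Icc (0 : ℝ) 1)
    (hs : ∀ i, Tendsto (fun n => ∑ j ∈ Finset.range n, a i j) atTop atTop)
    (hz : ∀ i, Tendsto (averaging (a i) (w i)) atTop (𝓝 0))
    (hd : ∀ i n, d i (n + 1) = (1 - a i n) * d i n + a i n * (G i n + w i n))
    (hG : ∀ n c, (∀ i, |d i n| ≤ c) → ∀ i, |G i n| ≤ γ * c)
    (hK : ∀ i n, |d i n| ≤ K) (i : ι) : Tendsto (d i) atTop (𝓝 0) := by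
  -- Once the averaged noise is subtracted, `d` obeys a noiseless recursion with inputs at most `γ *
  -- c`; half of `ε` pays for that recursion, half for the averaged noise.
  have step : ∀ c ε, 0 < ε → (∀ᶠ n in atTop, ∀ i, |d i n| ≤ c) →
      ∀ᶠ n in atTop, ∀ i, |d i n| ≤ γ * c + ε := by
    intro c ε hε hc
    obtain ⟨N, hN⟩ := eventually_atTop.1 hc
    rw [eventually_all]
    intro i
    have h1 := eventually_le_add_of_averaging
      (y := fun n => |d i n - averaging (a i) (w i) n|) (c := γ * c) (ha i) (hs i) N
      (fun n hn => by
        have e1 : d i (n + 1) - averaging (a i) (w i) (n + 1) =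
            (1 - a i n) * (d i n - averaging (a i) (w i) n) + a i n * G i n := by
          simp only [hd, averaging]; ring
        rw [e1]
        refine (abs_add_le _ _).trans ?_
        rw [abs_mul, abs_mul, abs_of_nonneg (ha i n).1,
          abs_of_nonneg (show 0 ≤ 1 - a i n by linarith [(ha i n).2])]
        gcongr
        · exact (ha i n).1
        · exact hG n c (hN n hn) i) (ε := ε / 2) (by positivity)
    have h2 := (hz i).abs
    rw [abs_zero] at h2
    filter_upwards [h1, h2.eventually (gt_mem_nhds (half_pos hε))] with n h1 h2
    have := abs_add_le (d i n - averaging (a i) (w i) n) (averaging (a i) (w i) n)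
    rw [sub_add_cancel] at this
    linarith
  set T : Set ℝ := {c | 0 ≤ c ∧ ∀ᶠ n in atTop, ∀ i, |d i n| ≤ c} with hT
  have hbdd : BddBelow T := ⟨0, fun c hc => hc.1⟩
  have hne : T.Nonempty := ⟨K, (abs_nonneg _).trans (hK i 0), Eventually.of_forall fun n i => hK i n⟩
  have h0 : 0 ≤ sInf T := le_csInf hne fun c hc => hc.1
  have hInf : sInf T ≤ 0 := by
    by_contra! hpos
    -- With δ = (1 - γ) inf T / 4, a bound c < inf T + δ improves to γc + δ < inf T - 2δ,
    -- contradicting the infimum.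
    have hlt : sInf T < sInf T + (1 - γ) * sInf T / 4 := by nlinarith
    obtain ⟨c, hcT, hc⟩ := exists_lt_of_csInf_lt hne hlt
    have hε : 0 < (1 - γ) * sInf T / 4 := by nlinarith
    have := step c _ hε hcT.2
    have h2 := csInf_le hbdd (show γ * c + (1 - γ) * sInf T / 4 ∈ T from
      ⟨by nlinarith [hcT.1, mul_nonneg hγ0 hcT.1], this⟩)
    nlinarith
  rw [Metric.tendsto_nhds]
  intro ε hε
  obtain ⟨c, hcT, hc⟩ := exists_lt_of_csInf_lt hne (hInf.trans_lt hε)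
  filter_upwards [hcT.2] with n hn
  simpa using (hn i).trans_lt hc

/-! ### Almost sure convergence of weighted noise series. -/

section
variable {Ω E : Type*} {m mΩ : MeasurableSpace Ω} [MeasurableSpace E] {P : Measure Ω}
  [IsProbabilityMeasure P]

/-- Joint distribution of a sample and a random variable that is known before it is drawn. -/
theorem map_restrict_prodMk_eq_prod (hm : m ≤ mΩ) {N : Set Ω}
    (hN : MeasurableSet[m] N) {X : Ω → E} (hX : Measurable X) {κ : Measure E}
    [IsProbabilityMeasure κ]
    (hκ : ∀ D, MeasurableSet[m] D → D ⊆ N → (P.restrict D).map X = P D • κ)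
    {ρ : Ω → ℝ} (hρ : Measurable[m] ρ) :
    (P.restrict N).map (fun ω => (ρ ω, X ω)) = ((P.restrict N).map ρ).prod κ := by
  symm
  have hρ' : Measurable ρ := hρ.mono hm le_rfl
  refine Measure.prod_eq fun s t hs ht => ?_
  -- On a rectangle, the condition on `ρ` is absorbed into the past event to which `hκ` applies.
  have hD : MeasurableSet[m] (ρ ⁻¹' s ∩ N) := (hρ hs).inter hN
  have h1 := congrArg (fun μ => μ t) (hκ _ hD Set.inter_subset_right)
  simp only [Measure.smul_apply, smul_eq_mul] at h1
  rw [Measure.map_apply hX ht, Measure.restrict_apply (hX ht)] at h1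
  rw [Measure.map_apply (hρ'.prodMk hX) (hs.prod ht),
    Measure.restrict_apply ((hρ'.prodMk hX) (hs.prod ht)), Measure.map_apply hρ' hs,
    Measure.restrict_apply (hρ' hs), ← h1]
  congr 1
  ext ω
  simp only [Set.mem_inter_iff, Set.mem_preimage, Set.mem_prod]
  tauto

/-- On `N` the past and the sample have a product law, and off `N` the weight vanishes. No
integrability is required, as the product formula for Bochner integrals holds with the default value
0. -/
theorem integral_mul_sample (hm : m ≤ mΩ) {N : Set Ω}
    (hN : MeasurableSet[m] N) {X : Ω → E} (hX : Measurable X) {κ : Measure E}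
    [IsProbabilityMeasure κ]
    (hκ : ∀ D, MeasurableSet[m] D → D ⊆ N → (P.restrict D).map X = P D • κ)
    {ρ : Ω → ℝ} (hρ : Measurable[m] ρ) (hρN : ∀ ω, ω ∉ N → ρ ω = 0) {h : E → ℝ}
    (hh : Measurable h) :
    ∫ ω, ρ ω * h (X ω) ∂P = (∫ ω, ρ ω ∂P) * ∫ x, h x ∂κ := by
  have hρ' : Measurable ρ := hρ.mono hm le_rfl
  rw [← setIntegral_eq_integral_of_forall_compl_eq_zero (s := N)
      (f := fun ω => ρ ω * h (X ω)) (fun ω hω => by simp [hρN ω hω]),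
    ← setIntegral_eq_integral_of_forall_compl_eq_zero (s := N) (f := ρ) hρN]
  have h1 := integral_prod_mul (μ := (P.restrict N).map ρ) (ν := κ) (fun x : ℝ => x) h
  rw [← map_restrict_prodMk_eq_prod hm hN hX hκ hρ, integral_map (hρ'.prodMk hX).aemeasurable
    (by fun_prop), integral_map hρ'.aemeasurable (by fun_prop)] at h1
  exact h1

theorem integrable_mul_sample (hm : m ≤ mΩ) {N : Set Ω}
    (hN : MeasurableSet[m] N) {X : Ω → E} (hX : Measurable X) {κ : Measure E}
    [IsProbabilityMeasure κ]
    (hκ : ∀ D, MeasurableSet[m] D → D ⊆ N → (P.restrict D).map X = P D • κ)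
    {ρ : Ω → ℝ} (hρ : Measurable[m] ρ) (hρN : ∀ ω, ω ∉ N → ρ ω = 0) (hρi : Integrable ρ P)
    {h : E → ℝ} (hh : Measurable h) (hhi : Integrable h κ) :
    Integrable (fun ω => ρ ω * h (X ω)) P := by
  have hρ' : Measurable ρ := hρ.mono hm le_rfl
  have h1 : Integrable (fun z : ℝ × E => z.1 * h z.2) (((P.restrict N).map ρ).prod κ) := by
    refine Integrable.mul_prod (f := fun x : ℝ => x) ?_ hhi
    rw [integrable_map_measure (by fun_prop) hρ'.aemeasurable]
    exact hρi.restrict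
  rw [← map_restrict_prodMk_eq_prod hm hN hX hκ hρ, integrable_map_measure (by fun_prop)
    (hρ'.prodMk hX).aemeasurable] at h1
  refine (integrableOn_iff_integrable_of_support_subset (s := N) ?_).1 h1
  intro ω hω
  by_contra hN
  exact hω (by simp [hρN ω hN])

/-- A series of predictably weighted centred samples converges if the weights are square summable:
the case in which the sum of the squares of the weights is bounded. -/
theorem exists_tendsto_sum_mul_sample_of_bounded {ℱ : Filtration ℕ mΩ} {N : ℕ → Set Ω}
    (hN : ∀ j, MeasurableSet[ℱ j] (N j)) {X : ℕ → Ω → E}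
    (hX : ∀ j, Measurable[ℱ (j + 1)] (X j)) {κ : Measure E} [IsProbabilityMeasure κ]
    (hκ : ∀ j D, MeasurableSet[ℱ j] D → D ⊆ N j → (P.restrict D).map (X j) = P D • κ)
    {β : ℕ → Ω → ℝ} (hβ : ∀ j, Measurable[ℱ j] (β j)) (hβN : ∀ j ω, ω ∉ N j → β j ω = 0)
    {h : E → ℝ} (hh : Measurable h) (hh2 : MemLp h 2 κ) (hh0 : ∫ x, h x ∂κ = 0)
    {K : ℝ} (hK : ∀ n ω, ∑ j ∈ Finset.range n, (β j ω) ^ 2 ≤ K) :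
    ∀ᵐ ω ∂P, ∃ l, Tendsto (fun n => ∑ j ∈ Finset.range n, β j ω * h (X j ω)) atTop (𝓝 l) := by
  have hβK : ∀ j ω, (β j ω) ^ 2 ≤ K := fun j ω => by
    have := hK (j + 1) ω
    rw [Finset.sum_range_succ] at this
    linarith [Finset.sum_nonneg fun i (_ : i ∈ Finset.range j) => sq_nonneg (β i ω)]
  have hβ1 : ∀ j ω, |β j ω| ≤ 1 + K := fun j ω => by
    have := hβK j ω
    rw [← sq_abs] at this
    nlinarith [sq_nonneg (|β j ω| - 1)]
  have hβ' : ∀ j, Measurable (β j) := fun j => (hβ j).mono (ℱ.le j) le_rfl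
  have hX' : ∀ j, Measurable (X j) := fun j => (hX j).mono (ℱ.le _) le_rfl
  have hhi : Integrable h κ := hh2.integrable (by norm_num)
  have hhsq : Integrable (fun x => h x ^ 2) κ := hh2.integrable_sq
  have hβi : ∀ j, Integrable (β j) P := fun j =>
    Integrable.of_bound (hβ' j).aestronglyMeasurable (1 + K)
      (Eventually.of_forall fun ω => hβ1 j ω)
  have hβsq : ∀ j, Integrable (fun ω => β j ω ^ 2) P := fun j =>
    Integrable.of_bound ((hβ' j).pow_const 2).aestronglyMeasurable K
      (Eventually.of_forall fun ω => by
        rw [Real.norm_of_nonneg (sq_nonneg _)]; exact hβK j ω)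
  set d : ℕ → Ω → ℝ := fun j ω => β j ω * h (X j ω) with hd
  set M : ℕ → Ω → ℝ := fun n ω => ∑ j ∈ Finset.range n, d j ω with hM
  have hdm : ∀ j, Measurable[ℱ (j + 1)] (d j) := fun j =>
    Measurable.mul ((hβ j).mono (ℱ.mono j.le_succ) le_rfl) (hh.comp (hX j))
  have hMm : ∀ n, Measurable[ℱ n] (M n) := fun n =>
    Finset.measurable_sum _ fun j hj => (hdm j).mono (ℱ.mono (Finset.mem_range.1 hj)) le_rfl
  have hdi : ∀ j, Integrable (d j) P := fun j =>
    integrable_mul_sample (ℱ.le j) (hN j) (hX' j) (hκ j) (hβ j) (hβN j) (hβi j) hh hhi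
  have hMi : ∀ n, Integrable (M n) P := fun n => integrable_finsetSum _ fun j _ => hdi j
  have hMsucc : ∀ n ω, M (n + 1) ω = M n ω + d n ω := fun n ω => Finset.sum_range_succ _ _
  have hmart : Martingale M ℱ P := by
    refine martingale_of_setIntegral_eq_succ (fun n => (hMm n).stronglyMeasurable) hMi ?_
    intro n s hs
    have hs' := ℱ.le n s hs
    have h1 : ∫ ω in s, d n ω ∂P = 0 := by
      have := integral_mul_sample (ℱ.le n) (hN n) (hX' n) (hκ n)
        (ρ := s.indicator (β n)) ((hβ n).indicator hs)
        (fun ω hω => by simp [Set.indicator, hβN n ω hω]) hh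
      rw [hh0, mul_zero] at this
      rw [← integral_indicator hs', ← this]
      congr 1
      ext ω
      by_cases h : ω ∈ s <;> simp [h, hd]
    simp only [hMsucc]
    rw [integral_add (hMi n).integrableOn (hdi n).integrableOn, h1, add_zero]
  have hdsq : ∀ j, Integrable (fun ω => d j ω ^ 2) P := fun j => by
    have := integrable_mul_sample (ℱ.le j) (hN j) (hX' j) (hκ j) (ρ := fun ω => β j ω ^ 2)
      ((hβ j).pow_const 2) (fun ω hω => by simp [hβN j ω hω]) (hβsq j) (hh.pow_const 2) hhsq
    simpa only [hd, mul_pow] using this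
  have hdsqI : ∀ j, ∫ ω, d j ω ^ 2 ∂P = (∫ ω, β j ω ^ 2 ∂P) * ∫ x, h x ^ 2 ∂κ := fun j => by
    have := integral_mul_sample (ℱ.le j) (hN j) (hX' j) (hκ j) (ρ := fun ω => β j ω ^ 2)
      ((hβ j).pow_const 2) (fun ω hω => by simp [hβN j ω hω]) (hh.pow_const 2)
    simpa only [hd, mul_pow] using this
  have hMβ : ∀ n, Integrable (fun ω => M n ω * β n ω) P := fun n =>
    (hMi n).mul_bdd (c := 1 + K) (hβ' n).aestronglyMeasurable
      (Eventually.of_forall fun ω => hβ1 n ω)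
  have hMd : ∀ n, Integrable (fun ω => M n ω * d n ω) P := fun n => by
    have := integrable_mul_sample (ℱ.le n) (hN n) (hX' n) (hκ n) (ρ := fun ω => M n ω * β n ω)
      ((hMm n).mul (hβ n)) (fun ω hω => by simp [hβN n ω hω]) (hMβ n) hh hhi
    simpa only [hd, mul_assoc] using this
  -- Orthogonality of the increments: `M n * β n` is known before the centred sample is drawn, so
  -- the cross term has mean zero.
  have hMd0 : ∀ n, ∫ ω, M n ω * d n ω ∂P = 0 := fun n => by
    have := integral_mul_sample (ℱ.le n) (hN n) (hX' n) (hκ n) (ρ := fun ω => M n ω * β n ω)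
      ((hMm n).mul (hβ n)) (fun ω hω => by simp [hβN n ω hω]) hh
    rw [hh0, mul_zero] at this
    simpa only [hd, mul_assoc] using this
  have hMsq : ∀ n, Integrable (fun ω => M n ω ^ 2) P ∧
      ∫ ω, M n ω ^ 2 ∂P = (∫ ω, ∑ j ∈ Finset.range n, β j ω ^ 2 ∂P) * ∫ x, h x ^ 2 ∂κ := by
    intro n
    induction n with
    | zero => simp [hM]
    | succ n ih =>
      have e : ∀ ω, M (n + 1) ω ^ 2 = M n ω ^ 2 + (2 * (M n ω * d n ω) + d n ω ^ 2) := fun ω => by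
        rw [hMsucc]; ring
      have i2 : Integrable (fun ω => 2 * (M n ω * d n ω) + d n ω ^ 2) P :=
        ((hMd n).const_mul 2).add (hdsq n)
      simp only [e, Finset.sum_range_succ]
      refine ⟨ih.1.add i2, ?_⟩
      rw [integral_add ih.1 i2, integral_add ((hMd n).const_mul 2) (hdsq n),
        integral_const_mul, hMd0, hdsqI, ih.2,
        integral_add (integrable_finsetSum _ fun j _ => hβsq j) (hβsq n)]
      ring
  have hV0 : 0 ≤ ∫ x, h x ^ 2 ∂κ := integral_nonneg fun x => sq_nonneg _
  have hMsqK : ∀ n, ∫ ω, M n ω ^ 2 ∂P ≤ K * ∫ x, h x ^ 2 ∂κ := fun n => by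
    rw [(hMsq n).2]
    refine mul_le_mul_of_nonneg_right ?_ hV0
    have := integral_mono (μ := P) (integrable_finsetSum (Finset.range n) fun j _ => hβsq j)
      (integrable_const K) (fun ω => hK n ω)
    simpa using this
  -- The L² bound becomes the L¹ bound of the martingale convergence theorem through |x| ≤ 1 + x².
  have hL1 : ∀ n, eLpNorm (M n) 1 P ≤ (1 + K * ∫ x, h x ^ 2 ∂κ).toNNReal := fun n => by
    rw [eLpNorm_one_eq_lintegral_enorm, ← ofReal_integral_norm_eq_lintegral_enorm (hMi n)]
    refine ENNReal.ofReal_le_ofReal ?_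
    have : ∫ ω, ‖M n ω‖ ∂P ≤ ∫ ω, (1 + M n ω ^ 2) ∂P := by
      refine integral_mono (hMi n).norm ((integrable_const 1).add (hMsq n).1) fun ω => ?_
      simp only [Real.norm_eq_abs]
      nlinarith [sq_nonneg (|M n ω| - 1), sq_abs (M n ω), abs_nonneg (M n ω)]
    rw [integral_add (integrable_const 1) (hMsq n).1] at this
    simp only [integral_const, probReal_univ, smul_eq_mul, mul_one] at this
    linarith [hMsqK n]
  filter_upwards [hmart.submartingale.ae_tendsto_limitProcess hL1] with ω hω
  exact ⟨_, hω⟩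

/-- A series of predictably weighted centred samples converges if the weights are square
summable. -/
theorem exists_tendsto_sum_mul_sample {ℱ : Filtration ℕ mΩ} {N : ℕ → Set Ω}
    (hN : ∀ j, MeasurableSet[ℱ j] (N j)) {X : ℕ → Ω → E}
    (hX : ∀ j, Measurable[ℱ (j + 1)] (X j)) {κ : Measure E} [IsProbabilityMeasure κ]
    (hκ : ∀ j D, MeasurableSet[ℱ j] D → D ⊆ N j → (P.restrict D).map (X j) = P D • κ)
    {β : ℕ → Ω → ℝ} (hβ : ∀ j, Measurable[ℱ j] (β j)) (hβN : ∀ j ω, ω ∉ N j → β j ω = 0)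
    {h : E → ℝ} (hh : Measurable h) (hh2 : MemLp h 2 κ) (hh0 : ∫ x, h x ∂κ = 0)
    (hsum : ∀ᵐ ω ∂P, Summable fun j => (β j ω) ^ 2) :
    ∀ᵐ ω ∂P, ∃ l, Tendsto (fun n => ∑ j ∈ Finset.range n, β j ω * h (X j ω)) atTop (𝓝 l) := by
  set s : ℕ → Ω → ℝ := fun n ω => ∑ j ∈ Finset.range n, β j ω ^ 2 with hs
  -- Localisation: the sum up to and including `β j` is already `ℱ j`-measurable, so weights can be
  -- switched off before their squares add up to more than `K`.
  set D : ℕ → ℕ → Set Ω := fun K j => {ω | s (j + 1) ω ≤ K} with hD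
  have hDm : ∀ K j, MeasurableSet[ℱ j] (D K j) := fun K j =>
    measurableSet_le (Finset.measurable_sum _ fun i hi =>
      ((hβ i).mono (ℱ.mono (Nat.lt_succ_iff.1 (Finset.mem_range.1 hi))) le_rfl).pow_const 2)
      measurable_const
  have hmono : ∀ ω, Monotone fun n => s n ω := fun ω => monotone_nat_of_le_succ fun n => by
    simp only [hs, Finset.sum_range_succ]; linarith [sq_nonneg (β n ω)]
  have key : ∀ K : ℕ, ∀ᵐ ω ∂P, ∃ l, Tendsto
      (fun n => ∑ j ∈ Finset.range n, (D K j).indicator (β j) ω * h (X j ω)) atTop (𝓝 l) := by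
    intro K
    refine exists_tendsto_sum_mul_sample_of_bounded hN hX hκ
      (fun j => (hβ j).indicator (hDm K j))
      (fun j ω hω => by simp [Set.indicator, hβN j ω hω]) hh hh2 hh0 (K := K) ?_
    intro n ω
    induction n with
    | zero => simp
    | succ n ih =>
      by_cases hn : ω ∈ D K n
      · refine le_trans (Finset.sum_le_sum (g := fun j => β j ω ^ 2) fun j _ => ?_) hn
        by_cases hj : ω ∈ D K j <;> simp [hj, sq_nonneg]
      · rw [Finset.sum_range_succ]
        simpa [hn] using ih
  filter_upwards [ae_all_iff.2 key, hsum] with ω hω hsω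
  obtain ⟨K, hK⟩ := exists_nat_ge (∑' j, β j ω ^ 2)
  obtain ⟨l, hl⟩ := hω K
  refine ⟨l, hl.congr fun n => Finset.sum_congr rfl fun j _ => ?_⟩
  have : ω ∈ D K j := (hsω.sum_le_tsum _ fun i _ => sq_nonneg _).trans hK
  rw [Set.indicator_of_mem this]
end

/-! ### The Bellman equations. -/

theorem abs_ciSup_sub_ciSup_le {β : Type*} [Finite β] [Nonempty β] {f g : β → ℝ} {c : ℝ}
    (h : ∀ b, |f b - g b| ≤ c) : |(⨆ b, f b) - ⨆ b, g b| ≤ c := by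
  have hf : BddAbove (Set.range f) := (Set.finite_range f).bddAbove
  have hg : BddAbove (Set.range g) := (Set.finite_range g).bddAbove
  rw [abs_sub_le_iff]
  constructor
  · rw [sub_le_iff_le_add]
    exact ciSup_le fun b => by linarith [(abs_le.1 (h b)).2, le_ciSup hg b]
  · rw [sub_le_iff_le_add]
    exact ciSup_le fun b => by linarith [(abs_le.1 (h b)).1, le_ciSup hf b]

namespace MDP

section
variable {S : Type*} [MeasurableSpace S] {A : S → Type*}

instance (M : MDP S A) (s : S) (a : A s) : IsProbabilityMeasure (M.law s a) :=
  M.isProbabilityMeasure_law s a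

theorem abs_integral_comp_fst_le (M : MDP S A) {f : S → ℝ} {c : ℝ} (h : ∀ s, |f s| ≤ c)
    (s : S) (a : A s) : |∫ x, f x.1 ∂(M.law s a)| ≤ c := by
  have := norm_integral_le_of_norm_le_const (μ := M.law s a) (f := fun x : S × ℝ => f x.1)
    (Eventually.of_forall fun x => h x.1)
  simpa using this

theorem exists_abs_expectedUtility_le [Finite S] [∀ s, Finite (A s)] (M : MDP S A)
    (Φ : ∀ s, A s) :
    ∃ R, ∀ t s (a : A s), |M.expectedUtility Φ t s a| ≤ R := by
  obtain ⟨R, hR⟩ := (Set.finite_range fun i : Σ s, A s =>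
    |∫ x, x.2 ∂(M.law i.1 i.2)|).bddAbove
  refine ⟨R, fun t => ?_⟩
  induction t with
  | zero => exact fun s a => hR ⟨⟨s, a⟩, rfl⟩
  | succ t ih =>
    exact fun s a => M.abs_integral_comp_fst_le
      (f := fun y => M.expectedUtility Φ t y (Φ y)) (fun y => ih y (Φ y)) s a

variable [Finite S] [MeasurableSingletonClass S]

theorem integrable_comp_fst (M : MDP S A) (f : S → ℝ) (s : S) (a : A s) :
    Integrable (fun x : S × ℝ => f x.1) (M.law s a) := by
  obtain ⟨c, hc⟩ := (Set.finite_range fun s => ‖f s‖).bddAbove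
  exact Integrable.of_bound ((measurable_of_finite f).comp measurable_fst).aestronglyMeasurable c
    (Eventually.of_forall fun x => hc ⟨x.1, rfl⟩)

theorem abs_integral_comp_fst_sub_le (M : MDP S A) {f g : S → ℝ} {c : ℝ}
    (h : ∀ s, |f s - g s| ≤ c) (s : S) (a : A s) :
    |(∫ x, f x.1 ∂(M.law s a)) - ∫ x, g x.1 ∂(M.law s a)| ≤ c := by
  rw [← integral_sub (M.integrable_comp_fst f s a) (M.integrable_comp_fst g s a)]
  exact M.abs_integral_comp_fst_le (f := fun s => f s - g s) h s a

variable [∀ s, Finite (A s)]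

/-- The term t = 0 is split off, and the rest of the series is exchanged with the integral by
geometric domination. -/
theorem policyQ_eq (M : MDP S A) {γ : ℝ} (hγ0 : 0 ≤ γ) (hγ1 : γ < 1) (Φ : ∀ s, A s)
    (s : S) (a : A s) : M.policyQ γ Φ s a =
      (∫ x, x.2 ∂(M.law s a)) + γ * ∫ x, M.policyQ γ Φ x.1 (Φ x.1) ∂(M.law s a) := by
  obtain ⟨R, hR⟩ := M.exists_abs_expectedUtility_le Φ
  have hb : ∀ t s (a : A s), ‖γ ^ t * M.expectedUtility Φ t s a‖ ≤ γ ^ t * R := fun t s a => by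
    rw [norm_mul, norm_pow, Real.norm_of_nonneg hγ0]
    exact mul_le_mul_of_nonneg_left (hR t s a) (pow_nonneg hγ0 t)
  have hg : Summable fun t => γ ^ t * R := (summable_geometric_of_lt_one hγ0 hγ1).mul_right R
  have hsum : ∀ s (a : A s), Summable fun t => γ ^ t * M.expectedUtility Φ t s a := fun s a =>
    Summable.of_norm_bounded hg fun t => hb t s a
  have hswap := integral_tsum_of_summable_integral_norm (μ := M.law s a)
    (F := fun t (x : S × ℝ) => γ ^ t * M.expectedUtility Φ t x.1 (Φ x.1))
    (fun t => M.integrable_comp_fst (fun y => γ ^ t * M.expectedUtility Φ t y (Φ y)) s a)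
    (Summable.of_norm_bounded hg fun t => by
      have := M.abs_integral_comp_fst_le (c := γ ^ t * R)
        (f := fun y => ‖γ ^ t * M.expectedUtility Φ t y (Φ y)‖)
        (fun y => by rw [abs_norm]; exact hb t y (Φ y)) s a
      exact this)
  unfold policyQ
  rw [← hswap, (hsum s a).tsum_eq_zero_add, ← tsum_mul_left]
  congr 1
  · simp [expectedUtility]
  · refine tsum_congr fun t => ?_
    rw [integral_const_mul, pow_succ]
    simp only [expectedUtility]
    ring

/-- Maximum principle: at a pair where v - w is largest, the maximum is at most γ times itself,
hence nonpositive. -/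
theorem le_of_sub_le_integral (M : MDP S A) {γ : ℝ} (hγ0 : 0 ≤ γ) (hγ1 : γ < 1) (Φ : ∀ s, A s)
    {v w : ∀ s, A s → ℝ}
    (h : ∀ s a, v s a - w s a ≤
      γ * ∫ x, (v x.1 (Φ x.1) - w x.1 (Φ x.1)) ∂(M.law s a)) (s : S) (a : A s) :
    v s a ≤ w s a := by
  have : Nonempty (Σ s, A s) := ⟨⟨s, a⟩⟩
  obtain ⟨⟨s₀, a₀⟩, hmax⟩ := Finite.exists_max fun i : Σ s, A s => v i.1 i.2 - w i.1 i.2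
  have h1 : ∫ x, (v x.1 (Φ x.1) - w x.1 (Φ x.1)) ∂(M.law s₀ a₀) ≤ v s₀ a₀ - w s₀ a₀ := by
    have := integral_mono
      (M.integrable_comp_fst (fun y => v y (Φ y) - w y (Φ y)) s₀ a₀)
      (integrable_const (v s₀ a₀ - w s₀ a₀)) (fun x => hmax ⟨x.1, Φ x.1⟩)
    simpa using this
  have h2 := h s₀ a₀
  have h3 := mul_le_mul_of_nonneg_left h1 hγ0
  have h4 := hmax ⟨s, a⟩
  simp only at h4
  nlinarith

variable [∀ s, Nonempty (A s)]

/-- The Bellman optimality equation has a solution. -/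
theorem exists_bellman_fixedPoint (M : MDP S A) {γ : ℝ} (hγ0 : 0 ≤ γ) (hγ1 : γ < 1) :
    ∃ q : ∀ s, A s → ℝ, ∀ s a,
      q s a = (∫ x, x.2 ∂(M.law s a)) + γ * ∫ x, (⨆ b, q x.1 b) ∂(M.law s a) := by
  cases nonempty_fintype S
  have (s : S) : Fintype (A s) := Fintype.ofFinite _
  let T : (∀ s, A s → ℝ) → ∀ s, A s → ℝ := fun q s a =>
    (∫ x, x.2 ∂(M.law s a)) + γ * ∫ x, (⨆ b, q x.1 b) ∂(M.law s a)
  have hT : ContractingWith ⟨γ, hγ0⟩ T := by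
    refine ⟨by exact_mod_cast hγ1, LipschitzWith.of_dist_le_mul fun q q' => ?_⟩
    have h0 : 0 ≤ γ * dist q q' := mul_nonneg hγ0 dist_nonneg
    refine (dist_pi_le_iff h0).2 fun s => (dist_pi_le_iff h0).2 fun a => ?_
    have := M.abs_integral_comp_fst_sub_le (f := fun y => ⨆ b, q y b) (g := fun y => ⨆ b, q' y b)
      (c := dist q q') (fun y => abs_ciSup_sub_ciSup_le fun b =>
        (dist_le_pi_dist (q y) (q' y) b).trans (dist_le_pi_dist q q' y)) s a
    rw [Real.dist_eq, add_sub_add_left_eq_sub, ← mul_sub, abs_mul, abs_of_nonneg hγ0]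
    exact mul_le_mul_of_nonneg_left this hγ0
  exact ⟨hT.fixedPoint, fun s a => (congrFun (congrFun hT.fixedPoint_isFixedPt s) a).symm⟩

/-- The optimal Q-function solves the Bellman optimality equation. -/
theorem optimalQ_eq (M : MDP S A) {γ : ℝ} (hγ0 : 0 ≤ γ) (hγ1 : γ < 1) (s : S) (a : A s) :
    M.optimalQ γ s a =
      (∫ x, x.2 ∂(M.law s a)) + γ * ∫ x, (⨆ b, M.optimalQ γ x.1 b) ∂(M.law s a) := by
  obtain ⟨q, hq⟩ := M.exists_bellman_fixedPoint hγ0 hγ1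
  have hle : ∀ Φ s a, M.policyQ γ Φ s a ≤ q s a := fun Φ =>
    M.le_of_sub_le_integral hγ0 hγ1 Φ fun s a => by
      rw [M.policyQ_eq hγ0 hγ1, hq s a, add_sub_add_left_eq_sub, ← mul_sub,
        ← integral_sub (M.integrable_comp_fst (fun y => M.policyQ γ Φ y (Φ y)) s a)
          (M.integrable_comp_fst (fun y => ⨆ b, q y b) s a)]
      refine mul_le_mul_of_nonneg_left (integral_mono
        (M.integrable_comp_fst (fun y => M.policyQ γ Φ y (Φ y) - ⨆ b, q y b) s a)
        (M.integrable_comp_fst (fun y => M.policyQ γ Φ y (Φ y) - q y (Φ y)) s a)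
        fun x => ?_) hγ0
      exact sub_le_sub_left (le_ciSup (Set.finite_range (q x.1)).bddAbove (Φ x.1)) _
  -- The policy greedy for `q` turns the supremum into evaluation at `Φ`, so `q` is attained as its
  -- Q-function.
  choose Φ hΦ using fun s => exists_eq_ciSup_of_finite (f := q s)
  have hge : ∀ s a, q s a ≤ M.policyQ γ Φ s a :=
    M.le_of_sub_le_integral hγ0 hγ1 Φ fun s a => by
      nth_rewrite 1 [hq s a]
      simp only [← hΦ]
      rw [M.policyQ_eq hγ0 hγ1, add_sub_add_left_eq_sub, ← mul_sub,
        ← integral_sub (M.integrable_comp_fst (fun y => q y (Φ y)) s a)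
          (M.integrable_comp_fst (fun y => M.policyQ γ Φ y (Φ y)) s a)]
  have hopt : M.optimalQ γ = q := by
    ext s a
    exact le_antisymm (ciSup_le fun Φ => hle Φ s a) ((hge s a).trans
      (le_ciSup (f := fun Φ => M.policyQ γ Φ s a) (Set.finite_range _).bddAbove Φ))
  rw [hopt]
  exact hq s a

end
end MDP

/-! ### Outdated copies and boundedness of discounted iterations. -/

theorem tendsto_zero_of_tendsto_sum_range {f : ℕ → ℝ} {l : ℝ}
    (h : Tendsto (fun n => ∑ j ∈ Finset.range n, f j) atTop (𝓝 l)) : Tendsto f atTop (𝓝 0) := by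
  have := (h.comp (tendsto_add_atTop_nat 1)).sub h
  simpa [Function.comp_def, Finset.sum_range_succ] using this

/-- A copy of a sequence that is refreshed every `C` steps is asymptotic to the sequence if the
increments vanish. -/
theorem tendsto_refreshed_sub {x : ℕ → ℝ} (hx : Tendsto (fun n => x (n + 1) - x n) atTop (𝓝 0))
    {C : ℕ} (hC : 0 < C) : Tendsto (fun n => x (C * (n / C)) - x n) atTop (𝓝 0) := by
  have h1 : ∀ r, Tendsto (fun n => x (n + r) - x n) atTop (𝓝 0) := by
    intro r
    induction r with
    | zero => simp
    | succ r ih =>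
      have := (hx.comp (tendsto_add_atTop_nat r)).add ih
      simpa [Function.comp_def, add_assoc] using this
  -- Summing over all lags below `C` bounds the varying lag `n % C` by one null sequence.
  have h2 : Tendsto (fun m => ∑ r ∈ Finset.range C, |x (m + r) - x m|) atTop (𝓝 0) := by
    simpa using tendsto_finsetSum (Finset.range C) fun r _ => (h1 r).abs
  have h3 : Tendsto (fun n => C * (n / C)) atTop atTop :=
    (tendsto_id.const_mul_atTop' hC).comp (Nat.tendsto_div_const_atTop hC.ne')
  refine squeeze_zero_norm (fun n => ?_) (h2.comp h3)
  have h4 := Finset.single_le_sum (f := fun r => |x (C * (n / C) + r) - x (C * (n / C))|)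
    (fun r _ => abs_nonneg _) (Finset.mem_range.2 (Nat.mod_lt n hC))
  simp only [Nat.div_add_mod] at h4
  rw [Real.norm_eq_abs, abs_sub_comm]
  exact h4

/-- The averages minus `m` are averages of the centred inputs, hence tend to 0, even if the inputs
are unbounded. -/
theorem exists_averaging_le {a u : ℕ → ℝ} {l m : ℝ} (ha : ∀ n, a n ∈ Set.Icc (0 : ℝ) 1)
    (hs : Tendsto (fun n => ∑ j ∈ Finset.range n, a j) atTop atTop)
    (hu : Tendsto (fun n => ∑ j ∈ Finset.range n, a j * (u j - m)) atTop (𝓝 l)) :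
    ∃ V, ∀ n, averaging a u n ≤ V := by
  have h := tendsto_zero_of_averaging_noise (z := fun n => averaging a u n - m) ha hs
    (fun n => by simp only [averaging]; ring) hu
  obtain ⟨V, hV⟩ := h.bddAbove_range
  exact ⟨V + m, fun n => by linarith [hV ⟨n, rfl⟩]⟩

/-- An asynchronous iteration with discounted, possibly outdated, feedback is bounded if the
averages of its inputs are. -/
theorem exists_abs_le_of_discounted_averaging {ι : Type*} [Finite ι] {γ : ℝ}
    (hγ1 : γ < 1) {a q u : ι → ℕ → ℝ} (ha : ∀ i n, a i n ∈ Set.Icc (0 : ℝ) 1)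
    (hu : ∀ i n, 0 ≤ u i n) (hV : ∀ i, ∃ V, ∀ n, averaging (a i) (u i) n ≤ V)
    (hq : ∀ i n b, (∀ k ≤ n, ∀ i, |q i k| ≤ b) →
      |q i (n + 1)| ≤ (1 - a i n) * |q i n| + a i n * (u i n + γ * b)) :
    ∃ K, ∀ i n, |q i n| ≤ K := by
  choose V' hV' using hV
  obtain ⟨V, hVV⟩ := (Set.finite_range V').bddAbove
  obtain ⟨L, hL⟩ := (Set.finite_range fun i => |q i 0|).bddAbove
  have hv0 : ∀ i n, 0 ≤ averaging (a i) (u i) n := by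
    intro i n
    induction n with
    | zero => exact le_rfl
    | succ n ih =>
      exact add_nonneg (mul_nonneg (by linarith [(ha i n).2]) ih) (mul_nonneg (ha i n).1 (hu i n))
  have hvV : ∀ i n, averaging (a i) (u i) n ≤ |V| := fun i n =>
    ((hV' i n).trans (hVV ⟨i, rfl⟩)).trans (le_abs_self V)
  have hγ : 0 < 1 - γ := by linarith
  -- The condition on `K` means K ≥ γ|V|/(1 - γ): feedback from tables bounded by |V| + K then
  -- contributes at most K.
  obtain ⟨K, hKL, hKγ⟩ : ∃ K, L ≤ K ∧ γ * (|V| + K) ≤ K := by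
    refine ⟨max (|L|) (γ * |V| / (1 - γ)),
      (le_abs_self L).trans (le_max_left _ _), ?_⟩
    have := (div_le_iff₀ hγ).1 (le_max_right (|L|) (γ * |V| / (1 - γ)))
    linarith
  -- The averaged input is kept in the bound, since single inputs need not be bounded. Strong
  -- induction is needed because the feedback may come from any earlier time.
  have key : ∀ n i, |q i n| ≤ averaging (a i) (u i) n + K := by
    intro n
    induction n using Nat.strong_induction_on with
    | _ n ih =>
      intro i
      rcases n with _ | n
      · have := hL ⟨i, rfl⟩
        simp only [averaging] at this ⊢
        linarith
      · have h1 := hq i n (|V| + K) fun k hk i =>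
          (ih k (Nat.lt_succ_of_le hk) i).trans (by linarith [hvV i k])
        have h2 := mul_le_mul_of_nonneg_left (ih n n.lt_succ_self i)
          (show 0 ≤ 1 - a i n by linarith [(ha i n).2])
        have h3 := mul_le_mul_of_nonneg_left hKγ (ha i n).1
        simp only [averaging]
        linarith
  exact ⟨|V| + K, fun i n => (key n i).trans (by linarith [hvV i n])⟩

/-! ### Measurability and pathwise analysis of double Q-learning. -/

namespace MDP

section
variable {S : Type*} [MeasurableSpace S] {A : S → Type*}

theorem integral_comp_fst_eq_sum [Fintype S] [MeasurableSingletonClass S] (M : MDP S A)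
    (f : S → ℝ) (s : S) (a : A s) :
    ∫ x, f x.1 ∂(M.law s a) = ∑ y, (M.law s a).real (Prod.fst ⁻¹' {y}) * f y := by
  have : IsProbabilityMeasure ((M.law s a).map Prod.fst) :=
    Measure.isProbabilityMeasure_map measurable_fst.aemeasurable
  rw [← integral_map (φ := Prod.fst) (f := f) measurable_fst.aemeasurable
    (measurable_of_finite f).aestronglyMeasurable,
    integral_fintype (Integrable.of_finite)]
  refine Finset.sum_congr rfl fun y _ => ?_
  rw [map_measureReal_apply measurable_fst (measurableSet_singleton y), smul_eq_mul]

namespace IsDoubleQLearning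

variable {Ω : Type*} {mΩ : MeasurableSpace Ω} {M : MDP S A} {γ : ℝ} {C : ℕ} {P : Measure Ω}
  {ℱ : Filtration ℕ mΩ} {α : ℕ → ∀ s, A s → Ω → ℝ} {Y : ℕ → ∀ s, A s → Ω → S}
  {U : ℕ → ∀ s, A s → Ω → ℝ} {g : ℕ → ∀ s, Ω → A s} {Q : ℕ → ∀ s, A s → Ω → ℝ}

/-- The total weight is `α * c`, which vanishes off the event where the law of the sample is
prescribed. -/
theorem exists_tendsto_sum_mul_sample [IsProbabilityMeasure P]
    (hQ : M.IsDoubleQLearning γ C P ℱ α Y U g Q) (s : S) (a : A s)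
    {c : ℕ → Ω → ℝ} (hc : ∀ j, Measurable[ℱ j] (c j)) {h : S × ℝ → ℝ} (hh : Measurable h)
    (hh2 : MemLp h 2 (M.law s a)) (hh0 : ∫ x, h x ∂(M.law s a) = 0)
    (hsum : ∀ᵐ ω ∂P, Summable fun j => (α j s a ω * c j ω) ^ 2) :
    ∀ᵐ ω ∂P, ∃ l, Tendsto (fun n => ∑ j ∈ Finset.range n,
      α j s a ω * (c j ω * h (Y j s a ω, U j s a ω))) atTop (𝓝 l) := by
  have := _root_.exists_tendsto_sum_mul_sample (P := P) (ℱ := ℱ)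
    (N := fun j => {ω | α j s a ω ≠ 0}) (X := fun j ω => (Y j s a ω, U j s a ω))
    (β := fun j ω => α j s a ω * c j ω)
    (fun j => hQ.measurable_rate j s a (measurableSet_singleton (0 : ℝ)).compl)
    (fun j => (hQ.measurable_next j s a).prodMk (hQ.measurable_utility j s a))
    (fun j D hD hDN => hQ.sample j s a D hD hDN)
    (fun j => (hQ.measurable_rate j s a).mul (hc j))
    (fun j ω hω => by simp [not_not.1 hω]) hh hh2 hh0 hsum
  simpa only [mul_assoc] using this

theorem measurable_apply_greedy [∀ s, Finite (A s)]
    (hQ : M.IsDoubleQLearning γ C P ℱ α Y U g Q) {j k : ℕ} {s : S}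
    (h : ∀ b, Measurable[ℱ j] (Q k s b)) : Measurable[ℱ j] fun ω => Q k s (g j s ω) ω := by
  classical
  cases nonempty_fintype (A s)
  have e : (fun ω => Q k s (g j s ω) ω) =
      fun ω => ∑ b, ({ω | g j s ω = b}).indicator (Q k s b) ω := by
    ext ω
    simp [Set.indicator_apply]
  rw [e]
  exact Finset.measurable_sum _ fun b _ => (h b).indicator (hQ.measurable_greedy j s b)

/-- Bounded paths: the averages of the absolute utilities control the table. -/
theorem exists_abs_table_le [Finite S] [∀ s, Finite (A s)]
    (hQ : M.IsDoubleQLearning γ C P ℱ α Y U g Q) (hγ0 : 0 ≤ γ)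
    (hγ1 : γ < 1) {ω : Ω} (hα : ∀ s a,
      Tendsto (fun n => ∑ j ∈ Finset.range n, α j s a ω) atTop atTop)
    (hU : ∀ s a, ∃ m l, Tendsto (fun n => ∑ j ∈ Finset.range n,
      α j s a ω * (|U j s a ω| - m)) atTop (𝓝 l)) :
    ∃ K, ∀ j s a, |Q j s a ω| ≤ K := by
  obtain ⟨K, hK⟩ := exists_abs_le_of_discounted_averaging (ι := Σ s, A s) hγ1
    (a := fun i n => α n i.1 i.2 ω) (q := fun i n => Q n i.1 i.2 ω)
    (u := fun i n => |U n i.1 i.2 ω|) (fun i n => hQ.rate_mem n i.1 i.2 ω)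
    (fun i n => abs_nonneg _)
    (fun i => by
      obtain ⟨m, l, h⟩ := hU i.1 i.2
      exact exists_averaging_le (fun n => hQ.rate_mem n i.1 i.2 ω) (hα i.1 i.2) h)
    (fun i n b hb => by
      have ha := hQ.rate_mem n i.1 i.2 ω
      rw [hQ.update, show ∀ x t y : ℝ, x + t * (y - x) = (1 - t) * x + t * y by intros; ring]
      refine (abs_add_le _ _).trans ?_
      rw [abs_mul, abs_mul, abs_of_nonneg ha.1, abs_of_nonneg (sub_nonneg.2 ha.2)]
      refine add_le_add le_rfl (mul_le_mul_of_nonneg_left ((abs_add_le _ _).trans ?_) ha.1)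
      rw [abs_mul, abs_of_nonneg hγ0]
      exact add_le_add le_rfl (mul_le_mul_of_nonneg_left
        (hb _ (Nat.mul_div_le n C) ⟨Y n i.1 i.2 ω, g n (Y n i.1 i.2 ω) ω⟩) hγ0))
  exact ⟨K, fun j s a => hK ⟨s, a⟩ j⟩

variable [Finite S] [MeasurableSingletonClass S] [∀ s, Finite (A s)]

theorem measurable_table (hQ : M.IsDoubleQLearning γ C P ℱ α Y U g Q) (j : ℕ) :
    ∀ s a, Measurable[ℱ j] (Q j s a) := by
  classical
  induction j using Nat.strong_induction_on with
  | _ j ih =>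
    intro s a
    rcases j with _ | j
    · exact hQ.measurable_init s a
    · have hle : ℱ j ≤ ℱ (j + 1) := ℱ.mono j.le_succ
      cases nonempty_fintype S
      have e : (fun ω => Q (C * (j / C)) (Y j s a ω) (g j (Y j s a ω) ω) ω) = fun ω =>
          ∑ y, ({ω | Y j s a ω = y}).indicator (fun ω => Q (C * (j / C)) y (g j y ω) ω) ω := by
        ext ω
        simp [Set.indicator_apply]
      have h1 : Measurable[ℱ (j + 1)]
          fun ω => Q (C * (j / C)) (Y j s a ω) (g j (Y j s a ω) ω) ω := by
        rw [e]
        refine Finset.measurable_sum _ fun y _ => Measurable.indicator ?_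
          (hQ.measurable_next j s a (measurableSet_singleton y))
        exact (hQ.measurable_apply_greedy fun b =>
          (ih _ (Nat.lt_succ_of_le (Nat.mul_div_le j C)) y b).mono
            (ℱ.mono (Nat.mul_div_le j C)) le_rfl).mono hle le_rfl
      have h2 := (ih j j.lt_succ_self s a).mono hle le_rfl
      rw [funext (hQ.update j s a)]
      exact h2.add (((hQ.measurable_rate j s a).mono hle le_rfl).mul
        (((hQ.measurable_utility j s a).add (h1.const_mul γ)).sub h2))

theorem measurable_target (hQ : M.IsDoubleQLearning γ C P ℱ α Y U g Q) (j : ℕ) (s : S) :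
    Measurable[ℱ j] fun ω => Q (C * (j / C)) s (g j s ω) ω :=
  hQ.measurable_apply_greedy fun b =>
    (hQ.measurable_table _ s b).mono (ℱ.mono (Nat.mul_div_le j C)) le_rfl

/-- Convergence along a bounded path for which the series of the weighted deviations of the
targets from their conditional means converge. -/
theorem tendsto_optimalQ_of_path [∀ s, Nonempty (A s)]
    (hQ : M.IsDoubleQLearning γ C P ℱ α Y U g Q) (hγ0 : 0 ≤ γ) (hγ1 : γ < 1) (hC : 0 < C) {ω : Ω}
    (hα : ∀ s a, Tendsto (fun n => ∑ j ∈ Finset.range n, α j s a ω) atTop atTop)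
    (hα0 : ∀ s a, Tendsto (fun j => α j s a ω) atTop (𝓝 0))
    {K : ℝ} (hK : ∀ j s a, |Q j s a ω| ≤ K)
    (hW : ∀ s a, ∃ l, Tendsto (fun n => ∑ j ∈ Finset.range n, α j s a ω *
      (U j s a ω + γ * Q (C * (j / C)) (Y j s a ω) (g j (Y j s a ω) ω) ω -
        ((∫ x, x.2 ∂(M.law s a)) +
          γ * ∫ x, Q (C * (j / C)) x.1 (g j x.1 ω) ω ∂(M.law s a)))) atTop (𝓝 l))
    (s : S) (a : A s) : Tendsto (fun j => Q j s a ω) atTop (𝓝 (M.optimalQ γ s a)) := by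
  set r : ∀ s, A s → ℝ := fun s a => ∫ x, x.2 ∂(M.law s a) with hr
  set m : ℕ → ∀ s, A s → ℝ := fun j s a =>
    ∫ x, Q (C * (j / C)) x.1 (g j x.1 ω) ω ∂(M.law s a) with hm
  set w : ℕ → ∀ s, A s → ℝ := fun j s a =>
    U j s a ω + γ * Q (C * (j / C)) (Y j s a ω) (g j (Y j s a ω) ω) ω - (r s a + γ * m j s a)
    with hw
  have hupd : ∀ j s a, Q (j + 1) s a ω = Q j s a ω + α j s a ω *
      (w j s a + (r s a + γ * m j s a - Q j s a ω)) := fun j s a => by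
    rw [hQ.update]; simp only [hw]; ring
  have hmK : ∀ j s a, |m j s a| ≤ K := fun j s a =>
    M.abs_integral_comp_fst_le (f := fun y => Q (C * (j / C)) y (g j y ω) ω)
      (fun y => hK _ _ _) s a
  -- The noise part is the general term of a convergent series; the rest is a bounded quantity times
  -- a vanishing rate.
  have hinc : ∀ s a, Tendsto (fun j => Q (j + 1) s a ω - Q j s a ω) atTop (𝓝 0) := by
    intro s a
    obtain ⟨l, hl⟩ := hW s a
    have h1 := tendsto_zero_of_tendsto_sum_range hl
    have h2 : Tendsto (fun j => α j s a ω * (r s a + γ * m j s a - Q j s a ω)) atTop (𝓝 0) := by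
      have h3 := (hα0 s a).mul_const (|r s a| + γ * K + K)
      rw [zero_mul] at h3
      refine squeeze_zero_norm (fun j => ?_) h3
      rw [Real.norm_eq_abs, abs_mul, abs_of_nonneg (hQ.rate_mem j s a ω).1]
      refine mul_le_mul_of_nonneg_left ?_ (hQ.rate_mem j s a ω).1
      refine (abs_sub _ _).trans (add_le_add ((abs_add_le _ _).trans
        (add_le_add le_rfl ?_)) (hK j s a))
      rw [abs_mul, abs_of_nonneg hγ0]
      exact mul_le_mul_of_nonneg_left (hmK j s a) hγ0
    have h3 := h1.add h2
    rw [add_zero] at h3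
    refine h3.congr fun j => ?_
    rw [hupd]; ring
  have hlag : ∀ s a, Tendsto (fun j => Q (C * (j / C)) s a ω - Q j s a ω) atTop (𝓝 0) :=
    fun s a => tendsto_refreshed_sub (x := fun j => Q j s a ω) (hinc s a) hC
  have hmax : ∀ j s, ⨆ b, Q j s b ω = Q j s (g j s ω) ω := fun j s =>
    le_antisymm (ciSup_le fun b => hQ.greedy j s b ω)
      (le_ciSup (f := fun b => Q j s b ω) (Set.finite_range _).bddAbove _)
  -- The action is greedy for the current table but valued by the target, so the error against the
  -- current maximum is at most the lag between the tables.
  have herr : ∀ s a, Tendsto (fun j => γ * (m j s a -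
      ∫ x, (⨆ b, Q j x.1 b ω) ∂(M.law s a))) atTop (𝓝 0) := by
    intro s a
    cases nonempty_fintype (Σ s, A s)
    have h1 : Tendsto (fun j => ∑ i : Σ s, A s, |Q (C * (j / C)) i.1 i.2 ω - Q j i.1 i.2 ω|)
        atTop (𝓝 0) := by
      simpa using tendsto_finsetSum Finset.univ fun (i : Σ s, A s) _ => (hlag i.1 i.2).abs
    rw [← mul_zero γ]
    refine Tendsto.const_mul γ (squeeze_zero_norm (fun j => ?_) h1)
    refine M.abs_integral_comp_fst_sub_le (f := fun y => Q (C * (j / C)) y (g j y ω) ω)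
      (g := fun y => ⨆ b, Q j y b ω) (fun y => ?_) s a
    rw [hmax]
    exact Finset.single_le_sum
      (f := fun i : Σ s, A s => |Q (C * (j / C)) i.1 i.2 ω - Q j i.1 i.2 ω|)
      (fun i _ => abs_nonneg _) (Finset.mem_univ (⟨y, g j y ω⟩ : Σ s, A s))
  obtain ⟨L, hL⟩ := (Set.finite_range fun i : Σ s, A s => |M.optimalQ γ i.1 i.2|).bddAbove
  -- `G` is the difference of the Bellman operator at the current table and at Q*; `w` collects the
  -- lag error and the sampling noise.
  have := tendsto_zero_of_contracting_averaging (ι := Σ s, A s) (K := K + L) hγ0 hγ1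
    (a := fun i n => α n i.1 i.2 ω)
    (d := fun i n => Q n i.1 i.2 ω - M.optimalQ γ i.1 i.2)
    (G := fun i n => γ * ((∫ x, (⨆ b, Q n x.1 b ω) ∂(M.law i.1 i.2)) -
      ∫ x, (⨆ b, M.optimalQ γ x.1 b) ∂(M.law i.1 i.2)))
    (w := fun i n => γ * (m n i.1 i.2 - ∫ x, (⨆ b, Q n x.1 b ω) ∂(M.law i.1 i.2)) + w n i.1 i.2)
    (fun i n => hQ.rate_mem n i.1 i.2 ω) (fun i => hα i.1 i.2)
    (fun i => by
      obtain ⟨l, hl⟩ := hW i.1 i.2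
      exact tendsto_averaging_add_noise (fun n => hQ.rate_mem n i.1 i.2 ω) (hα i.1 i.2)
        (herr i.1 i.2) hl)
    (fun i n => by
      have hopt := M.optimalQ_eq hγ0 hγ1 i.1 i.2
      simp only [hupd, hr]
      linear_combination (-(α n i.1 i.2 ω)) * hopt)
    (fun n c hc i => by
      rw [abs_mul, abs_of_nonneg hγ0]
      exact mul_le_mul_of_nonneg_left (M.abs_integral_comp_fst_sub_le
        (f := fun y => ⨆ b, Q n y b ω) (g := fun y => ⨆ b, M.optimalQ γ y b)
        (fun y => abs_ciSup_sub_ciSup_le fun b => hc ⟨y, b⟩) i.1 i.2) hγ0)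
    (fun i n => (abs_sub _ _).trans (add_le_add (hK n i.1 i.2) (hL ⟨i, rfl⟩))) ⟨s, a⟩
  simpa using this.add_const (M.optimalQ γ s a)

end IsDoubleQLearning
end
end MDP

/-! ### Assembly of the almost sure statement. -/

theorem theorem4p1 {S : Type*} [Finite S] [MeasurableSpace S] [MeasurableSingletonClass S]
    {A : S → Type*} [∀ s, Finite (A s)] [∀ s, Nonempty (A s)]
    (M : MDP S A) (γ : ℝ) (hγ0 : 0 ≤ γ) (hγ1 : γ < 1) (C : ℕ) (hC : 0 < C)
    {Ω : Type*} {mΩ : MeasurableSpace Ω} (P : Measure Ω) [IsProbabilityMeasure P]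
    (ℱ : Filtration ℕ mΩ) (α : ℕ → ∀ s, A s → Ω → ℝ)
    (Y : ℕ → ∀ s, A s → Ω → S) (U : ℕ → ∀ s, A s → Ω → ℝ)
    (g : ℕ → ∀ s, Ω → A s) (Q : ℕ → ∀ s, A s → Ω → ℝ)
    (hQ : M.IsDoubleQLearning γ C P ℱ α Y U g Q)
    (hα : ∀ s a, ∀ᵐ ω ∂P,
      Tendsto (fun n => ∑ j ∈ Finset.range n, α j s a ω) atTop atTop)
    (hα2 : ∀ s a, ∀ᵐ ω ∂P, Summable (fun j => (α j s a ω) ^ 2))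
    (hVar : ∃ B : ℝ≥0, ∀ s a, evariance (fun x : S × ℝ => x.2) (M.law s a) ≤ B) :
    ∀ᵐ ω ∂P, ∀ s a, Tendsto (fun j => Q j s a ω) atTop (𝓝 (M.optimalQ γ s a)) := by
  cases nonempty_fintype S
  obtain ⟨B, hB⟩ := hVar
  have hL2 : ∀ s a, MemLp (fun x : S × ℝ => x.2) 2 (M.law s a) := fun s a =>
    (evariance_lt_top_iff_memLp measurable_snd.aestronglyMeasurable).1
      ((hB s a).trans_lt ENNReal.coe_lt_top)
  have hU : ∀ s a, ∀ᵐ ω ∂P, ∃ l, Tendsto (fun n => ∑ j ∈ Finset.range n,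
      α j s a ω * (U j s a ω - ∫ x, x.2 ∂(M.law s a))) atTop (𝓝 l) := by
    intro s a
    have := hQ.exists_tendsto_sum_mul_sample s a (c := fun _ _ => 1) (fun _ => measurable_const)
      (h := fun x => x.2 - ∫ x, x.2 ∂(M.law s a)) (by fun_prop)
      ((hL2 s a).sub (memLp_const _))
      (by rw [integral_sub ((hL2 s a).integrable (by norm_num)) (integrable_const _)]; simp)
      (by simpa using hα2 s a)
    simpa using this
  have hUabs : ∀ s a, ∀ᵐ ω ∂P, ∃ l, Tendsto (fun n => ∑ j ∈ Finset.range n,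
      α j s a ω * (|U j s a ω| - ∫ x, |x.2| ∂(M.law s a))) atTop (𝓝 l) := by
    intro s a
    have := hQ.exists_tendsto_sum_mul_sample s a (c := fun _ _ => 1) (fun _ => measurable_const)
      (h := fun x => |x.2| - ∫ x, |x.2| ∂(M.law s a)) (by fun_prop)
      ((hL2 s a).abs.sub (memLp_const _))
      (by
        rw [integral_sub (f := fun x : S × ℝ => |x.2|) ((hL2 s a).abs.integrable (by norm_num))
          (integrable_const _)]
        simp)
      (by simpa using hα2 s a)
    simpa using this
  have all : ∀ {p : ∀ s, A s → Ω → Prop}, (∀ s a, ∀ᵐ ω ∂P, p s a ω) →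
      ∀ᵐ ω ∂P, ∀ s a, p s a ω := fun h => ae_all_iff.2 fun s => ae_all_iff.2 fun a => h s a
  have hbdd : ∀ᵐ ω ∂P, ∃ K, ∀ j s a, |Q j s a ω| ≤ K := by
    filter_upwards [all hα, all hUabs] with ω h1 h2
    exact hQ.exists_abs_table_le hγ0 hγ1 h1 fun s a => ⟨_, h2 s a⟩
  -- The target at a random next state is split over the values `y`: a coefficient known in advance
  -- times a centred indicator. Its weights are square summable because almost every path is
  -- bounded.
  have hY : ∀ s a, ∀ᵐ ω ∂P, ∀ y, ∃ l, Tendsto (fun n => ∑ j ∈ Finset.range n,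
      α j s a ω * (Q (C * (j / C)) y (g j y ω) ω *
        ((Prod.fst ⁻¹' {y} : Set (S × ℝ)).indicator 1 (Y j s a ω, U j s a ω) -
          (M.law s a).real (Prod.fst ⁻¹' {y})))) atTop (𝓝 l) := by
    intro s a
    refine ae_all_iff.2 fun y => ?_
    have hE : MeasurableSet (Prod.fst ⁻¹' {y} : Set (S × ℝ)) :=
      measurable_fst (measurableSet_singleton y)
    refine hQ.exists_tendsto_sum_mul_sample s a
      (c := fun j ω => Q (C * (j / C)) y (g j y ω) ω) (fun j => hQ.measurable_target j y)
      (h := fun x => (Prod.fst ⁻¹' {y} : Set (S × ℝ)).indicator 1 x -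
        (M.law s a).real (Prod.fst ⁻¹' {y})) ((measurable_one.indicator hE).sub_const _)
      (((memLp_const (1 : ℝ)).indicator hE).sub (memLp_const _)) ?_ ?_
    · rw [integral_sub (f := (Prod.fst ⁻¹' {y} : Set (S × ℝ)).indicator 1)
        ((integrable_const (1 : ℝ)).indicator hE) (integrable_const _), integral_indicator_one hE]
      simp
    · filter_upwards [hα2 s a, hbdd] with ω h1 ⟨K, hK⟩
      refine Summable.of_nonneg_of_le (fun j => sq_nonneg _) (fun j => ?_) (h1.mul_right (K ^ 2))
      rw [mul_pow]
      exact mul_le_mul_of_nonneg_left (sq_le_sq' (abs_le.1 (hK _ _ _)).1 (abs_le.1 (hK _ _ _)).2)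
        (sq_nonneg _)
  filter_upwards [all hα, all hα2, all hU, all hY, hbdd] with ω h1 h2 h3 h4 ⟨K, hK⟩
  refine hQ.tendsto_optimalQ_of_path hγ0 hγ1 hC h1 (fun s a => ?_) hK fun s a => ?_
  · have := (h2 s a).tendsto_atTop_zero.sqrt
    simpa [Real.sqrt_sq (hQ.rate_mem _ s a ω).1] using this
  · obtain ⟨l, hl⟩ := h3 s a
    choose k hk using h4 s a
    -- The utility noise and the next-state noises recombine into the deviation of the whole target
    -- from its conditional mean.
    refine ⟨l + γ * ∑ y, k y, (hl.add ((tendsto_finsetSum Finset.univ fun y _ =>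
      hk y).const_mul γ)).congr fun n => ?_⟩
    rw [Finset.sum_comm, Finset.mul_sum, ← Finset.sum_add_distrib]
    refine Finset.sum_congr rfl fun j _ => ?_
    have e1 := M.integral_comp_fst_eq_sum (fun y => Q (C * (j / C)) y (g j y ω) ω) s a
    have e2 : ∑ y, Q (C * (j / C)) y (g j y ω) ω *
        (Prod.fst ⁻¹' {y} : Set (S × ℝ)).indicator 1 (Y j s a ω, U j s a ω) =
          Q (C * (j / C)) (Y j s a ω) (g j (Y j s a ω) ω) ω := by
      classical
      simp [Set.indicator_apply]
    rw [e1, ← e2, ← Finset.mul_sum]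
    simp only [mul_sub, Finset.sum_sub_distrib, mul_comm ((M.law s a).real _)]
    ring
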